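/- **Setting.** Let $\mathcal M_h=\mathcal T_h\cup\mathcal F_h\cup\mathcal E_h\cup\mathcal V_h$ be a finite polyhedral mesh of a domain $U\subset\mathbb R^3$ (elements $T$, planar polygonal faces $F$ with chosen unit normals $n_F$, edges $E$ with chosen unit tangents $t_E$, vertices $V$); faces and elements are simply connected with connected boundary and star-shaped with respect to a ball centred at $x_F$, resp. $x_T$. Let $h_{\mathsf P}$ be the diameter of $\mathsf P$, let $\omega_{TF}=\pm1$ be such that $\omega_{TF}n_F$ is outward for $T$, let $n_{FE}$ be the unit vector with $(t_E,n_{FE},n_F)$ right-handed, let $\omega_{FE}=\pm1$ be such that $\omega_{FE}n_{FE}$ is outward for $F$, and $\omega_{EV}=+1$ if $t_E$ points towards $V$, $-1$ otherwise. For each face (element) $\mathsf P$ select $\eta_{\mathsf P}\ge2$ of its edges (faces), spanning distinct lines (planes) and such that $\mathsf P$ lies on one side of each of these. Fix $k\ge0$ and set $\ell_{\mathsf P}=k+1-\eta_{\mathsf P}$. $\mathcal P^\ell(\mathsf P)$ is the space of polynomials of degree $\le\ell$ on $\mathsf P$ ($\{0\}$ if $\ell<0$); $\boldsymbol{\mathcal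 P}^\ell(\mathsf P)$ is its vector version (tangential on faces). Set $\mathcal R^\ell(F)=\mathrm{rot}_F\mathcal P^{\ell+1}(F)$, $\mathcal R^{c,\ell}(\mathsf P)=(x-x_{\mathsf P})\mathcal P^{\ell-1}(\mathsf P)$, $\mathcal R^\ell(T)=\mathrm{curl}\,\boldsymbol{\mathcal P}^{\ell+1}(T)$, $\mathcal G^\ell(T)=\mathrm{grad}\,\mathcal P^{\ell+1}(T)$, $\mathcal G^{c,\ell}(T)=(x-x_T)\times\boldsymbol{\mathcal P}^{\ell-1}(T)$, where $\mathrm{rot}_Fr=\mathrm{grad}_Fr\times n_F$. $L^2$-orthogonal projectors are denoted by $\pi$. **Spaces.** The elements of $X_{\mathrm{grad}}$ are the families $q=((q_T),(q_F),(q_E),(q_V))$ with $q_T\in\mathcal P^{\ell_T}(T)$, $q_F\in\mathcal P^{\ell_F}(F)$, $q_E\in\mathcal P^{k-1}(E)$, $q_V\in\mathbb R$; those of $X_{\mathrm{curl}}$ are $v=((v_T,v_T^c),(v_F,v_F^c),(v_E))$ with $v_{\mathsf P}\in\mathcal R^{k-1}(\mathsf P)$, $v^c_{\mathsf P}\in\mathcal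 R^{c,\ell_{\mathsf P}+1}(\mathsf P)$, $v_E\in\mathcal P^k(E)$; those of $X_{\mathrm{div}}$ are $w=((w_T,w_T^c),(w_F))$ with $w_T\in\mathcal G^{k-1}(T)$, $w_T^c\in\mathcal G^{c,k}(T)$, $w_F\in\mathcal P^k(F)$. A space with an argument $\mathsf P$ keeps only the components on $\mathsf P$ and on its boundary. **Local operators.** Let $S_{\mathrm{grad},\mathsf P}:X_{\mathrm{grad}}(\mathsf P)\to\boldsymbol{\mathcal P}^k(\mathsf P)$ and $S_{\mathrm{curl},\mathsf P}:X_{\mathrm{curl}}(\mathsf P)\to\boldsymbol{\mathcal P}^k(\mathsf P)$ (for $\mathsf P\in\mathcal T_h\cup\mathcal F_h$) be any linear maps (in particular, the usual serendipity operators). The following are defined by the stated relations, each of which has a unique solution: - $G_Eq\in\mathcal P^k(E)$: $\int_EG_Eq\,r=-\int_Eq_Er'+\sum_{V}\omega_{EV}q_Vr(x_V)$ for $r\in\mathcal P^k(E)$; $\gamma_Eq\in\mathcal P^{k+1}(E)$: $\gamma_Eq(x_V)=q_V$, $\pi^{k-1}_E\gamma_Eq=q_E$. - $G_Fq\in\boldsymbol{\mathcal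 P}^k(F)$: $\int_FG_Fq\cdot(w+\tau)=\sum_E\omega_{FE}\int_E\gamma_Eq\,(w\cdot n_{FE})+\int_FS_{\mathrm{grad},F}q\cdot\tau$ for $(w,\tau)\in\mathcal R^k(F)\times\mathcal R^{c,k}(F)$; $\gamma_Fq\in\mathcal P^{k+1}(F)$: $\int_F\gamma_Fq\,\mathrm{div}_Fw=-\int_FG_Fq\cdot w+\sum_E\omega_{FE}\int_E\gamma_Eq\,(w\cdot n_{FE})$ for $w\in\mathcal R^{c,k+2}(F)$. - $G_Tq\in\boldsymbol{\mathcal P}^k(T)$ and $P_{\mathrm{grad}}q|_T\in\mathcal P^{k+1}(T)$: the same two relations with $T,F,\omega_{TF},n_F,\gamma_F$ in place of $F,E,\omega_{FE},n_{FE},\gamma_E$. - $C_Fv\in\mathcal P^k(F)$: $\int_FC_Fv\,r=\int_Fv_F\cdot\mathrm{rot}_Fr-\sum_E\omega_{FE}\int_Ev_Er$ for $r\in\mathcal P^k(F)$; $\gamma_{t,F}v\in\boldsymbol{\mathcal P}^k(F)$: $\int_F\gamma_{t,F}v\cdot(\mathrm{rot}_Fr+\tau)=\int_FC_Fv\,r+\sum_E\omega_{FE}\int_Ev_Er+\int_FS_{\mathrm{curl},F}v\cdot\tau$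 for $r\in\mathcal P^{k+1}(F)$ of zero integral and $\tau\in\mathcal R^{c,k}(F)$. - $C_Tv\in\boldsymbol{\mathcal P}^k(T)$: $\int_TC_Tv\cdot w=\int_Tv_T\cdot\mathrm{curl}\,w+\sum_F\omega_{TF}\int_F\gamma_{t,F}v\cdot(w\times n_F)$ for $w\in\boldsymbol{\mathcal P}^k(T)$; $P_{\mathrm{curl}}v|_T\in\boldsymbol{\mathcal P}^k(T)$: $\int_TP_{\mathrm{curl}}v\cdot(\mathrm{curl}\,w+\tau)=\int_TC_Tv\cdot w-\sum_F\omega_{TF}\int_F\gamma_{t,F}v\cdot(w\times n_F)+\int_TS_{\mathrm{curl},T}v\cdot\tau$ for $(w,\tau)\in\mathcal G^{c,k+1}(T)\times\mathcal R^{c,k}(T)$. - $D_Tw\in\mathcal P^k(T)$: $\int_TD_Tw\,q=-\int_Tw_T\cdot\mathrm{grad}\,q+\sum_F\omega_{TF}\int_Fw_Fq$ for $q\in\mathcal P^k(T)$; $P_{\mathrm{div}}w|_T\in\boldsymbol{\mathcal P}^k(T)$: $\int_TP_{\mathrm{div}}w\cdot(\mathrm{grad}\,r+\tau)=-\int_TD_Tw\,r+\sum_F\omega_{TF}\int_Fw_Fr+\int_Tw_T^c\cdot\tau$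 for $r\in\mathcal P^{k+1}(T)$ of zero integral and $\tau\in\mathcal G^{c,k}(T)$. **Global operators.** $G_hq\in X_{\mathrm{curl}}$ has components $\pi_{\mathcal R^{k-1}(\mathsf P)}G_{\mathsf P}q$ and $\pi_{\mathcal R^{c,\ell_{\mathsf P}+1}(\mathsf P)}G_{\mathsf P}q$ ($\mathsf P=T,F$) and $G_Eq$; $C_hv\in X_{\mathrm{div}}$ has components $\pi_{\mathcal G^{k-1}(T)}C_Tv$, $\pi_{\mathcal G^{c,k}(T)}C_Tv$ and $C_Fv$; $\mathbf C_hv$ is the piecewise polynomial field equal to $C_Tv$ on $T$. The discrete products are $$(v,w)_{\mathrm{curl}}=\sum_T\Big[\int_TP_{\mathrm{curl}}v\cdot P_{\mathrm{curl}}w+\sum_{F\subset\partial T}h_F\int_F\big((P_{\mathrm{curl}}v)_{t,F}-\gamma_{t,F}v\big)\cdot\big((P_{\mathrm{curl}}w)_{t,F}-\gamma_{t,F}w\big)+\sum_{E\subset\partial T}h_E^2\int_E(P_{\mathrm{curl}}v\cdot t_E-v_E)(P_{\mathrm{curl}}w\cdot t_E-w_E)\Big],$$ $$(v,w)_{\mathrm{div}}=\sum_T\Big[\int_TP_{\mathrm{div}}v\cdot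 P_{\mathrm{div}}w+\sum_{F\subset\partial T}h_F\int_F(P_{\mathrm{div}}v\cdot n_F-v_F)(P_{\mathrm{div}}w\cdot n_F-w_F)\Big].$$ where $(\cdot)_{t,F}$ is the tangential trace and the traces are taken from $T$. **Lie algebra and scheme.** Let $\mathfrak g$ be a finite-dimensional real Lie algebra with an ad-invariant inner product $\langle\cdot,\cdot\rangle$. All spaces are tensorised with $\mathfrak g$, operators act componentwise, and inner products are tensorised with $\langle\cdot,\cdot\rangle$. On (piecewise) fields, $[v\otimes a,q\otimes b]=vq\otimes[a,b]$ and $\star[v\otimes a,w\otimes b]=(v\times w)\otimes[a,b]$. The discrete bracket $\star[v,w]_h\in X_{\mathrm{div}}\otimes\mathfrak g$ has components $\pi_{\mathcal G^{k-1}(T)}\star[P_{\mathrm{curl}}v,P_{\mathrm{curl}}w]$, $\pi_{\mathcal G^{c,k}(T)}\star[P_{\mathrm{curl}}v,P_{\mathrm{curl}}w]$ and $\pi_{\mathcal P^k(F)}(\star[\gamma_{t,F}v,\gamma_{t,F}w]\cdot n_F)$. Let $0=t^0<\dots<t^N$, $\delta^{n+1}v=(v^{n+1}-v^n)/(t^{n+1}-t^n)$,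 $A^{n+1/2}=\frac12(A^n+A^{n+1})$, and let $\mathfrak N$ be one of $$\mathfrak N_1(A^n,A^{n+1};v)=(C_hA^{n+1},\star[A^{n+1/2},v]_h)_{\mathrm{div}}+\big(\tfrac12\star[A^{n+1},A^{n+1}]_h,\,C_hv+\star[A^{n+1/2},v]_h\big)_{\mathrm{div}},$$ $$\mathfrak N_2(A^n,A^{n+1};v)=\int_U\langle\mathbf C_hA^{n+1},\star[P_{\mathrm{curl}}A^{n+1/2},P_{\mathrm{curl}}v]\rangle+\int_U\big\langle\tfrac12\star[P_{\mathrm{curl}}A^{n+1},P_{\mathrm{curl}}A^{n+1}],\,\mathbf C_hv+\star[P_{\mathrm{curl}}A^{n+1/2},P_{\mathrm{curl}}v]\big\rangle.$$ **Statement.** Let $A^n,E^n\in X_{\mathrm{curl}}\otimes\mathfrak g$ and $\lambda^n\in X_{\mathrm{grad}}\otimes\mathfrak g$ ($0\le n\le N$) satisfy, for all $0\le n<N$, all $v\in X_{\mathrm{curl}}\otimes\mathfrak g$ and all $q\in X_{\mathrm{grad}}\otimes\mathfrak g$, $$\delta^{n+1}A=-E^{n+1},$$ $$(\delta^{n+1}E,v)_{\mathrm{curl}}+(G_h\lambda^{n+1},v)_{\mathrm{curl}}+\int_U\langle[P_{\mathrm{curl}}A^{n+1},P_{\mathrm{grad}}\lambda^{n+1}],P_{\mathrm{curl}}v\rangle=(C_hA^{n+1},C_hv)_{\mathrm{div}}+\mathfrak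 N(A^n,A^{n+1};v),$$ $$(\delta^{n+1}E,G_hq)_{\mathrm{curl}}+\int_U\langle P_{\mathrm{curl}}\delta^{n+1}E,[P_{\mathrm{curl}}A^n,P_{\mathrm{grad}}q]\rangle=0.$$ Then, for every $q\in X_{\mathrm{grad}}\otimes\mathfrak g$, the quantity $$\mathfrak C^n(q)=(E^n,G_hq)_{\mathrm{curl}}+\int_U\langle P_{\mathrm{curl}}E^n,[P_{\mathrm{curl}}A^n,P_{\mathrm{grad}}q]\rangle$$ does not depend on $n\in\{0,\dots,N\}$. -/

import Mathlib

namespace YMDDR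

open MeasureTheory MvPolynomial
open scoped Matrix TensorProduct Topology

/-! ## Polynomials and polynomial vector fields on three-dimensional space -/

/-- The Euclidean space of dimension three. -/
abbrev E3 := EuclideanSpace ℝ (Fin 3)

/-- Real polynomials in three variables. -/
abbrev Pol := MvPolynomial (Fin 3) ℝ

/-- Polynomial vector fields. -/
abbrev VPol := Fin 3 → Pol

/-- Value of a polynomial at a point. -/
noncomputable def val (x : E3) (p : Pol) : ℝ := eval (fun i => x i) p

/-- The constant vector field `a`. -/
noncomputable def cst (a : E3) : VPol := fun i => C (a i)

/-- The vector field `x ↦ x - a`. -/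
noncomputable def rad (a : E3) : VPol := fun i => X i - C (a i)

/-- Gradient. -/
noncomputable def grad : Pol →ₗ[ℝ] VPol := LinearMap.pi fun i => (pderiv i).toLinearMap

/-- Directional derivative in the direction `a`. -/
noncomputable def dirDeriv (a : E3) : Pol →ₗ[ℝ] Pol := ∑ i, a i • (pderiv i).toLinearMap

/-- Divergence. -/
noncomputable def dvg (v : VPol) : Pol := ∑ i, pderiv i (v i)

/-- Curl. -/
noncomputable def curl : VPol →ₗ[ℝ] VPol where
  toFun v := ![pderiv 1 (v 2) - pderiv 2 (v 1), pderiv 2 (v 0) - pderiv 0 (v 2),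
    pderiv 0 (v 1) - pderiv 1 (v 0)]
  map_add' v w := by ext1 i; fin_cases i <;> simp <;> ring
  map_smul' c v := by ext1 i; fin_cases i <;> simp [smul_sub]

/-- The pointwise cross product as a bilinear map over the reals. -/
noncomputable def cross : VPol →ₗ[ℝ] VPol →ₗ[ℝ] VPol :=
  LinearMap.mk₂ ℝ (fun v w => v ⨯₃ w) (by simp) (fun c v w => by
    ext1 i; fin_cases i <;> simp [cross_apply, smul_sub]) (by simp) (fun c v w => by
    ext1 i; fin_cases i <;> simp [cross_apply, smul_sub])

/-- The pointwise dot product as a bilinear map over the reals. -/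
noncomputable def dot : VPol →ₗ[ℝ] VPol →ₗ[ℝ] Pol :=
  LinearMap.mk₂ ℝ (fun v w => v ⬝ᵥ w) (fun _ _ _ => add_dotProduct _ _ _)
    (fun c v w => smul_dotProduct c v w) (fun _ _ _ => dotProduct_add _ _ _)
    (fun c v w => dotProduct_smul c v w)

/-- Multiplication of a vector field by a scalar field. -/
noncomputable def scal : VPol →ₗ[ℝ] Pol →ₗ[ℝ] VPol :=
  LinearMap.mk₂ ℝ (fun v p => p • v) (fun _ _ _ => smul_add _ _ _)
    (fun c v p => smul_comm p c v) (fun v p q => add_smul p q v) (fun c v p => smul_assoc c p v)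

/-- The two-dimensional vector curl, in a plane with unit normal `n`: the rotation by `-π/2`
(in that plane, oriented by `n`) of the gradient. -/
noncomputable def vrot (n : E3) : Pol →ₗ[ℝ] VPol := cross.flip (cst n) ∘ₗ grad

/-- The two-dimensional scalar curl, in a plane with unit normal `n`: the divergence of the
rotation by `-π/2` of the field. -/
noncomputable def srot (n : E3) (v : VPol) : Pol := dvg (v ⨯₃ cst n)

/-- The tangential component `n × (v × n)` relative to the unit normal `n`. -/
noncomputable def tang (n : E3) : VPol →ₗ[ℝ] VPol := cross (cst n) ∘ₗ cross.flip (cst n)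

/-- Polynomials of total degree at most `ℓ`; the zero space if `ℓ < 0`. -/
noncomputable def polyDeg (ℓ : ℤ) : Submodule ℝ Pol :=
  if 0 ≤ ℓ then restrictTotalDegree (Fin 3) ℝ ℓ.toNat else ⊥

/-- The space `𝒫^ℓ(P)` of the restrictions to `P` of polynomials of degree at most `ℓ`. Each
restriction is represented by its unique polynomial extension that is constant in the directions
orthogonal to the affine span of `P` (no condition if `P` is three-dimensional). This extension has
the same degree bound, and its gradient is the gradient of the restriction along `P`. -/
noncomputable def polyOn (P : Set E3) (ℓ : ℤ) : Submodule ℝ Pol :=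
  polyDeg ℓ ⊓ ⨅ a : (vectorSpan ℝ P)ᗮ, LinearMap.ker (dirDeriv a)

/-- The space of vector polynomials on `P` of degree at most `ℓ`, with values in the tangent space
of `P` (no condition on the values if `P` is three-dimensional). -/
noncomputable def vPolyOn (P : Set E3) (ℓ : ℤ) : Submodule ℝ VPol :=
  Submodule.pi Set.univ (fun _ => polyOn P ℓ) ⊓
    ⨅ a : (vectorSpan ℝ P)ᗮ, LinearMap.ker (dot (cst a))

/-! ## Integration on the mesh entities -/

theorem continuous_val (p : Pol) : Continuous fun x : E3 => val x p :=
  (MvPolynomial.continuous_eval p).comp (by fun_prop)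

theorem measure_lt_top {d : ℕ} {K : Set E3} (hK : IsCompact K)
    (hd : Module.finrank ℝ (vectorSpan ℝ K) = d) : μHE[d] K < ⊤ := by
  rcases K.eq_empty_or_nonempty with rfl | ⟨p, hp⟩
  · simp
  · have hpK : p ∈ affineSpan ℝ K := subset_affineSpan ℝ K hp
    let q : affineSpan ℝ K := ⟨p, hpK⟩
    have : Nonempty (affineSpan ℝ K) := ⟨q⟩
    have hval : Subtype.val '' (Subtype.val ⁻¹' K : Set (affineSpan ℝ K)) = K := by
      ext x
      exact ⟨fun ⟨y, hy, hyx⟩ => hyx ▸ hy, fun hx => ⟨⟨x, subset_affineSpan ℝ K hx⟩, hx, rfl⟩⟩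
    have hd' : Module.finrank ℝ (affineSpan ℝ K).direction = d := by
      rw [direction_affineSpan, hd]
    have hc : IsCompact (Subtype.val ⁻¹' K : Set (affineSpan ℝ K)) := by
      rw [Subtype.isCompact_iff, hval]; exact hK
    rw [← hval, AffineSubspace.euclideanHausdorffMeasure_coe_image, ← hd',
      EuclideanGeometry.euclideanHausdorffMeasure_eq q]
    have he := (IsometryEquiv.vaddConst q).toHomeomorph.measurableEmbedding
    have : (volume.map (IsometryEquiv.vaddConst q)) (Subtype.val ⁻¹' K : Set (affineSpan ℝ K)) =
        volume ((IsometryEquiv.vaddConst q) ⁻¹' (Subtype.val ⁻¹' K)) := he.map_apply _ _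
    rw [this]
    have hc2 := (IsometryEquiv.vaddConst q).symm.toHomeomorph.isCompact_image.2 hc
    have himg : (IsometryEquiv.vaddConst q) ⁻¹' (Subtype.val ⁻¹' K) =
        (IsometryEquiv.vaddConst q).symm.toHomeomorph '' (Subtype.val ⁻¹' K) :=
      ((IsometryEquiv.vaddConst q).symm.toEquiv.image_eq_preimage_symm _).symm
    rw [himg]
    exact hc2.measure_lt_top

/-- The integral of polynomials over a compact set `K` of dimension `d`, with respect to the
`d`-dimensional volume (length for `d = 1`, area for `d = 2`, Lebesgue measure for `d = 3`). -/
noncomputable def integ (d : ℕ) (K : Set E3) (hK : IsCompact K)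
    (hd : Module.finrank ℝ (vectorSpan ℝ K) = d) : Pol →ₗ[ℝ] ℝ :=
  have hint : ∀ p : Pol, IntegrableOn (fun x => val x p) K μHE[d] := fun p =>
    (continuous_val p).continuousOn.integrableOn_of_subset_isCompact hK hK.measurableSet
      subset_rfl (measure_lt_top hK hd).ne
  { toFun := fun p => ∫ x in K, val x p ∂μHE[d]
    map_add' := fun p q => by
      rw [← integral_add (hint p) (hint q)]; simp [val]
    map_smul' := fun c p => by
      rw [RingHom.id_apply, smul_eq_mul, ← integral_const_mul]; simp [val, smul_eval] }

/-- The bilinear form `(v, w) ↦ I (v ⋅ w)` on vector fields, for a linear functional `I`. -/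
noncomputable def l2V (I : Pol →ₗ[ℝ] ℝ) : LinearMap.BilinForm ℝ VPol := dot.compr₂ I

/-- The bilinear form `(p, q) ↦ I (p q)` on scalar fields, for a linear functional `I`. -/
noncomputable def l2S (I : Pol →ₗ[ℝ] ℝ) : LinearMap.BilinForm ℝ Pol :=
  (LinearMap.mul ℝ Pol).compr₂ I

open scoped Classical in
/-- The linear map `S` such that `P x (S x)` holds for all `x`. It is used for variational problems
with data `x` that have a unique solution, depending linearly on `x`. (If there is no linear
solution map, the value is `0`.) -/
noncomputable def linSol {X V : Type} [AddCommGroup X] [Module ℝ X] [AddCommGroup V] [Module ℝ V]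
    (P : X → V → Prop) : X →ₗ[ℝ] V :=
  if h : ∃ S : X →ₗ[ℝ] V, ∀ x, P x (S x) then h.choose else 0

theorem linSol_spec {X V : Type} [AddCommGroup X] [Module ℝ X] [AddCommGroup V] [Module ℝ V]
    {P : X → V → Prop} (h : ∃ S : X →ₗ[ℝ] V, ∀ x, P x (S x)) (x : X) : P x (linSol P x) := by
  unfold linSol
  rw [dif_pos h]
  exact h.choose_spec x

/-- The `L²`-orthogonal projector of scalar fields on `W`, the integral being `I`. -/
noncomputable def projS (I : Pol →ₗ[ℝ] ℝ) (W : Submodule ℝ Pol) : Pol →ₗ[ℝ] W :=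
  linSol fun f (y : W) => ∀ w ∈ W, I (y * w) = I (f * w)

/-- The `L²`-orthogonal projector of vector fields on `W`, the integral being `I`. -/
noncomputable def projV (I : Pol →ₗ[ℝ] ℝ) (W : Submodule ℝ VPol) : VPol →ₗ[ℝ] W :=
  linSol fun f (y : W) => ∀ w ∈ W, I (y ⬝ᵥ w) = I (f ⬝ᵥ w)

/-! ## Polyhedral meshes -/

/-- A polyhedral mesh with finitely many elements, faces, edges and vertices. Edges are segments,
oriented from `tail` to `head`; faces are closed polygons, oriented by a unit normal; elements are
closed polyhedra. The elements partition (up to their boundaries) the domain `⋃ t, elem t`. -/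
structure PolyMesh where
  Elem : Type
  Face : Type
  Edge : Type
  Vert : Type
  [fintypeElem : Fintype Elem]
  [fintypeFace : Fintype Face]
  [fintypeEdge : Fintype Edge]
  [fintypeVert : Fintype Vert]
  pos : Vert → E3
  tail : Edge → Vert
  head : Edge → Vert
  face : Face → Set E3
  normal : Face → E3
  elem : Elem → Set E3
  /-- The points with respect to which faces and elements are star-shaped. -/
  centerF : Face → E3
  centerT : Elem → E3
  pos_injective : Function.Injective pos
  tail_ne_head : ∀ e, tail e ≠ head e
  norm_normal : ∀ f, ‖normal f‖ = 1
  vectorSpan_face : ∀ f, vectorSpan ℝ (face f) = (ℝ ∙ normal f)ᗮ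
  isCompact_face : ∀ f, IsCompact (face f)
  closure_face : ∀ f, closure (intrinsicInterior ℝ (face f)) = face f
  /-- The boundary of a face is a union of edges. -/
  boundary_face : ∀ f, ∀ x ∈ intrinsicFrontier ℝ (face f), ∃ e,
    x ∈ segment ℝ (pos (tail e)) (pos (head e)) ∧
      segment ℝ (pos (tail e)) (pos (head e)) ⊆ intrinsicFrontier ℝ (face f)
  nonempty_elem : ∀ t, (elem t).Nonempty
  isCompact_elem : ∀ t, IsCompact (elem t)
  closure_elem : ∀ t, closure (interior (elem t)) = elem t
  /-- The boundary of an element is a union of faces. -/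
  boundary_elem : ∀ t, ∀ x ∈ frontier (elem t), ∃ f, x ∈ face f ∧ face f ⊆ frontier (elem t)
  /-- Faces and elements are topologically trivial. -/
  simplyConnected_face : ∀ f, SimplyConnectedSpace (face f)
  simplyConnected_elem : ∀ t, SimplyConnectedSpace (elem t)
  isConnected_boundary_face : ∀ f, IsConnected (intrinsicFrontier ℝ (face f))
  isConnected_boundary_elem : ∀ t, IsConnected (frontier (elem t))
  /-- The open mesh entities are pairwise disjoint. -/
  disjoint_elem : ∀ t t', t ≠ t' → Disjoint (interior (elem t)) (interior (elem t'))
  disjoint_face : ∀ f f', f ≠ f' →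
    Disjoint (intrinsicInterior ℝ (face f)) (intrinsicInterior ℝ (face f'))
  disjoint_edge : ∀ e e', e ≠ e' → Disjoint (openSegment ℝ (pos (tail e)) (pos (head e)))
    (openSegment ℝ (pos (tail e')) (pos (head e')))
  disjoint_face_edge : ∀ f e,
    Disjoint (intrinsicInterior ℝ (face f)) (segment ℝ (pos (tail e)) (pos (head e)))
  disjoint_edge_vert : ∀ e v, pos v ∉ openSegment ℝ (pos (tail e)) (pos (head e))
  /-- Every face (edge, vertex) belongs to the boundary of an element (face, edge). -/
  exists_elem : ∀ f, ∃ t, face f ⊆ frontier (elem t)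
  exists_face : ∀ e, ∃ f,
    segment ℝ (pos (tail e)) (pos (head e)) ⊆ intrinsicFrontier ℝ (face f)
  exists_edge : ∀ v, ∃ e, v = tail e ∨ v = head e
  /-- Faces and elements are star-shaped with respect to a ball around their centre. -/
  centerF_mem : ∀ f, centerF f ∈ face f
  starConvex_face : ∀ f, ∃ r > 0, ∀ y ∈ Metric.ball (centerF f) r,
    y ∈ affineSpan ℝ (face f) → StarConvex ℝ y (face f)
  centerT_mem : ∀ t, centerT t ∈ elem t
  starConvex_elem : ∀ t, ∃ r > 0, ∀ y ∈ Metric.ball (centerT t) r, StarConvex ℝ y (elem t)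

namespace PolyMesh

attribute [instance] fintypeElem fintypeFace fintypeEdge fintypeVert

variable (M : PolyMesh)

/-- An edge as a set. -/
def seg (e : M.Edge) : Set E3 := segment ℝ (M.pos (M.tail e)) (M.pos (M.head e))

/-- The unit tangent of an edge. -/
noncomputable def tangent (e : M.Edge) : E3 :=
  ‖M.pos (M.head e) - M.pos (M.tail e)‖⁻¹ • (M.pos (M.head e) - M.pos (M.tail e))

open scoped Classical in
/-- The vertices of an edge. -/
noncomputable def vertsE (e : M.Edge) : Finset M.Vert := {M.tail e, M.head e}

open scoped Classical in
/-- The edges of a face. -/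
noncomputable def edgesF (f : M.Face) : Finset M.Edge :=
  Finset.univ.filter fun e => M.seg e ⊆ intrinsicFrontier ℝ (M.face f)

open scoped Classical in
/-- The vertices of a face. -/
noncomputable def vertsF (f : M.Face) : Finset M.Vert := (M.edgesF f).biUnion M.vertsE

open scoped Classical in
/-- The faces of an element. -/
noncomputable def facesT (t : M.Elem) : Finset M.Face :=
  Finset.univ.filter fun f => M.face f ⊆ frontier (M.elem t)

open scoped Classical in
/-- The edges of an element. -/
noncomputable def edgesT (t : M.Elem) : Finset M.Edge := (M.facesT t).biUnion M.edgesF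

open scoped Classical in
/-- The vertices of an element. -/
noncomputable def vertsT (t : M.Elem) : Finset M.Vert := (M.edgesT t).biUnion M.vertsE

theorem mem_vertsF {f : M.Face} {e : M.Edge} (he : e ∈ M.edgesF f) {v : M.Vert}
    (hv : v ∈ M.vertsE e) : v ∈ M.vertsF f := by
  classical exact Finset.mem_biUnion.2 ⟨e, he, hv⟩

theorem mem_edgesT {t : M.Elem} {f : M.Face} (hf : f ∈ M.facesT t) {e : M.Edge}
    (he : e ∈ M.edgesF f) : e ∈ M.edgesT t := by
  classical exact Finset.mem_biUnion.2 ⟨f, hf, he⟩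

theorem mem_vertsT {t : M.Elem} {f : M.Face} (hf : f ∈ M.facesT t) {v : M.Vert}
    (hv : v ∈ M.vertsF f) : v ∈ M.vertsT t := by
  classical
  obtain ⟨e, he, hv⟩ := Finset.mem_biUnion.1 hv
  exact Finset.mem_biUnion.2 ⟨e, M.mem_edgesT hf he, hv⟩

open scoped Classical in
/-- The orientation of a vertex relative to an edge: `1` if the tangent points towards the
vertex. -/
noncomputable def ωEV (e : M.Edge) (v : M.Vert) : ℝ := if v = M.head e then 1 else -1

/-- The unit vector `n_FE` in the plane of `f`, normal to `e`, such that `(t_E, n_FE, n_F)` is a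
right-handed system. -/
noncomputable def normalFE (f : M.Face) (e : M.Edge) : E3 :=
  WithLp.toLp 2 ((M.normal f).ofLp ⨯₃ (M.tangent e).ofLp)

open scoped Classical in
/-- The orientation of an edge relative to a face: `1` if `n_FE` points outside the face, so that
`ω_FE n_FE` is the outer normal, as in the integration by parts formulas on the face. -/
noncomputable def ωFE (f : M.Face) (e : M.Edge) : ℝ :=
  if ∀ x ∈ openSegment ℝ (M.pos (M.tail e)) (M.pos (M.head e)),
    ∀ᶠ s in 𝓝[>] (0 : ℝ), x + s • M.normalFE f e ∉ M.face f then 1 else -1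

open scoped Classical in
/-- The orientation of a face relative to an element: `1` if the normal points outside. -/
noncomputable def ωTF (t : M.Elem) (f : M.Face) : ℝ :=
  if ∀ x ∈ intrinsicInterior ℝ (M.face f),
    ∀ᶠ s in 𝓝[>] (0 : ℝ), x + s • M.normal f ∉ M.elem t then 1 else -1

theorem isCompact_seg (e : M.Edge) : IsCompact (M.seg e) := by
  unfold seg
  rw [segment_eq_image_lineMap]
  exact isCompact_Icc.image (AffineMap.lineMap_continuous)

theorem finrank_seg (e : M.Edge) : Module.finrank ℝ (vectorSpan ℝ (M.seg e)) = 1 := by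
  have h : vectorSpan ℝ (M.seg e) = ℝ ∙ (M.pos (M.head e) - M.pos (M.tail e)) := by
    rw [← direction_affineSpan, seg, ← convexHull_pair, affineSpan_convexHull, direction_affineSpan,
      vectorSpan_pair_rev, vsub_eq_sub]
  rw [h]
  exact finrank_span_singleton (sub_ne_zero.2 fun hh => M.tail_ne_head e (M.pos_injective hh).symm)

theorem finrank_face (f : M.Face) : Module.finrank ℝ (vectorSpan ℝ (M.face f)) = 2 := by
  have hn : M.normal f ≠ 0 := fun h => by simpa [h] using M.norm_normal f
  have := Submodule.finrank_add_finrank_orthogonal (ℝ ∙ M.normal f)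
  rw [M.vectorSpan_face]
  rw [finrank_span_singleton hn, finrank_euclideanSpace_fin] at this
  omega

theorem finrank_elem (t : M.Elem) : Module.finrank ℝ (vectorSpan ℝ (M.elem t)) = 3 := by
  have h : (interior (M.elem t)).Nonempty := by
    rw [← closure_nonempty_iff, M.closure_elem]
    exact M.nonempty_elem t
  have : affineSpan ℝ (M.elem t) = ⊤ :=
    top_unique ((isOpen_interior.affineSpan_eq_top h).symm.le.trans
      (affineSpan_mono ℝ interior_subset))
  rw [← direction_affineSpan, this, AffineSubspace.direction_top, finrank_top,
    finrank_euclideanSpace_fin]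

/-- The integral over an edge. -/
noncomputable def intE (e : M.Edge) : Pol →ₗ[ℝ] ℝ :=
  integ 1 (M.seg e) (M.isCompact_seg e) (M.finrank_seg e)

/-- The integral over a face. -/
noncomputable def intF (f : M.Face) : Pol →ₗ[ℝ] ℝ :=
  integ 2 (M.face f) (M.isCompact_face f) (M.finrank_face f)

/-- The integral over an element. -/
noncomputable def intT (t : M.Elem) : Pol →ₗ[ℝ] ℝ :=
  integ 3 (M.elem t) (M.isCompact_elem t) (M.finrank_elem t)

/-- The field `x ↦ x - x_F` on a face, extended constantly in the normal direction. -/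
noncomputable def radF (f : M.Face) : VPol := tang (M.normal f) (rad (M.centerF f))

/-- `ℛ^ℓ(F) = rot_F 𝒫^{ℓ+1}(F)`. -/
noncomputable def RolyF (f : M.Face) (ℓ : ℤ) : Submodule ℝ VPol :=
  (polyOn (M.face f) (ℓ + 1)).map (vrot (M.normal f))

/-- `ℛ^{c,ℓ}(F) = (x - x_F) 𝒫^{ℓ-1}(F)`. -/
noncomputable def RolycF (f : M.Face) (ℓ : ℤ) : Submodule ℝ VPol :=
  (polyOn (M.face f) (ℓ - 1)).map (scal (M.radF f))

/-- `ℛ^ℓ(T) = curl 𝒫^{ℓ+1}(T)³`. -/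
noncomputable def RolyT (t : M.Elem) (ℓ : ℤ) : Submodule ℝ VPol :=
  (vPolyOn (M.elem t) (ℓ + 1)).map curl

/-- `ℛ^{c,ℓ}(T) = (x - x_T) 𝒫^{ℓ-1}(T)`. -/
noncomputable def RolycT (t : M.Elem) (ℓ : ℤ) : Submodule ℝ VPol :=
  (polyOn (M.elem t) (ℓ - 1)).map (scal (rad (M.centerT t)))

/-- `𝒢^ℓ(T) = grad 𝒫^{ℓ+1}(T)`. -/
noncomputable def GolyT (t : M.Elem) (ℓ : ℤ) : Submodule ℝ VPol :=
  (polyOn (M.elem t) (ℓ + 1)).map grad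

/-- `𝒢^{c,ℓ}(T) = (x - x_T) × 𝒫^{ℓ-1}(T)³`. -/
noncomputable def GolycT (t : M.Elem) (ℓ : ℤ) : Submodule ℝ VPol :=
  (vPolyOn (M.elem t) (ℓ - 1)).map (cross (rad (M.centerT t)))

end PolyMesh

/-- The choice, for each face (element), of a set of at least two of its edges (faces) that are not
pairwise aligned and such that the face (element) lies on one side of each of them. -/
structure BoundarySelection (M : PolyMesh) where
  bdryF : M.Face → Finset M.Edge
  bdryT : M.Elem → Finset M.Face
  bdryF_subset : ∀ f, bdryF f ⊆ M.edgesF f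
  bdryT_subset : ∀ t, bdryT t ⊆ M.facesT t
  two_le_bdryF : ∀ f, 2 ≤ (bdryF f).card
  two_le_bdryT : ∀ t, 2 ≤ (bdryT t).card
  not_aligned_bdryF : ∀ f, ∀ e ∈ bdryF f, ∀ e' ∈ bdryF f, e ≠ e' →
    affineSpan ℝ (M.seg e) ≠ affineSpan ℝ (M.seg e')
  not_aligned_bdryT : ∀ t, ∀ f ∈ bdryT t, ∀ f' ∈ bdryT t, f ≠ f' →
    affineSpan ℝ (M.face f) ≠ affineSpan ℝ (M.face f')
  one_side_bdryF : ∀ f, ∀ e ∈ bdryF f, ∀ y ∈ M.seg e,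
    (∀ x ∈ M.face f, 0 ≤ inner ℝ (x - y) (M.normalFE f e)) ∨
      (∀ x ∈ M.face f, inner ℝ (x - y) (M.normalFE f e) ≤ 0)
  one_side_bdryT : ∀ t, ∀ f ∈ bdryT t, ∀ y ∈ M.face f,
    (∀ x ∈ M.elem t, 0 ≤ inner ℝ (x - y) (M.normal f)) ∨
      (∀ x ∈ M.elem t, inner ℝ (x - y) (M.normal f) ≤ 0)

section SDDR

variable {M : PolyMesh} (B : BoundarySelection M) (k : ℕ)

/-- The degree `ℓ_F = k + 1 - η_F`. -/
def degF (f : M.Face) : ℤ := (k : ℤ) + 1 - (B.bdryF f).card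

/-- The degree `ℓ_T = k + 1 - η_T`. -/
def degT (t : M.Elem) : ℤ := (k : ℤ) + 1 - (B.bdryT t).card

/-! ### The discrete spaces, on a mesh entity (and its boundary) and on the whole mesh -/

/-- Polynomial component of the gradient space on an edge. -/
abbrev GradE (e : M.Edge) : Type := polyOn (M.seg e) ((k : ℤ) - 1)

/-- Polynomial component of the gradient space on a face. -/
abbrev GradF (f : M.Face) : Type := polyOn (M.face f) (degF B k f)

/-- Polynomial component of the gradient space on an element. -/
abbrev GradT (t : M.Elem) : Type := polyOn (M.elem t) (degT B k t)

/-- The gradient space on an edge: `(q_E, (q_V)_V)`. -/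
abbrev XgradE (e : M.Edge) : Type := GradE k e × (M.vertsE e → ℝ)

/-- The gradient space on a face: `(q_F, (q_E)_E, (q_V)_V)`. -/
abbrev XgradF (f : M.Face) : Type :=
  GradF B k f × (∀ e : M.edgesF f, GradE k e.1) × (M.vertsF f → ℝ)

/-- The gradient space on an element: `(q_T, (q_F)_F, (q_E)_E, (q_V)_V)`. -/
abbrev XgradT (t : M.Elem) : Type :=
  GradT B k t × (∀ f : M.facesT t, GradF B k f.1) × (∀ e : M.edgesT t, GradE k e.1) ×
    (M.vertsT t → ℝ)

/-- The gradient space on the mesh: `((q_T)_T, (q_F)_F, (q_E)_E, (q_V)_V)`. -/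
abbrev Xgrad : Type :=
  (∀ t : M.Elem, GradT B k t) × (∀ f : M.Face, GradF B k f) × (∀ e : M.Edge, GradE k e) ×
    (M.Vert → ℝ)

/-- Polynomial component of the curl space on an edge. -/
abbrev CurlE (e : M.Edge) : Type := polyOn (M.seg e) (k : ℤ)

/-- Polynomial components of the curl space on a face. -/
abbrev CurlF (f : M.Face) : Type := M.RolyF f ((k : ℤ) - 1) × M.RolycF f (degF B k f + 1)

/-- Polynomial components of the curl space on an element. -/
abbrev CurlT (t : M.Elem) : Type := M.RolyT t ((k : ℤ) - 1) × M.RolycT t (degT B k t + 1)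

/-- The curl space on a face: `((v_F, v_F^c), (v_E)_E)`. -/
abbrev XcurlF (f : M.Face) : Type := CurlF B k f × (∀ e : M.edgesF f, CurlE k e.1)

/-- The curl space on an element: `((v_T, v_T^c), (v_F, v_F^c)_F, (v_E)_E)`. -/
abbrev XcurlT (t : M.Elem) : Type :=
  CurlT B k t × (∀ f : M.facesT t, CurlF B k f.1) × (∀ e : M.edgesT t, CurlE k e.1)

/-- The curl space on the mesh: `((v_T, v_T^c)_T, (v_F, v_F^c)_F, (v_E)_E)`. -/
abbrev Xcurl : Type :=
  (∀ t : M.Elem, CurlT B k t) × (∀ f : M.Face, CurlF B k f) × (∀ e : M.Edge, CurlE k e)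

/-- Polynomial component of the divergence space on a face. -/
abbrev DivF (f : M.Face) : Type := polyOn (M.face f) (k : ℤ)

/-- Polynomial components of the divergence space on an element. -/
abbrev DivT (t : M.Elem) : Type := M.GolyT t ((k : ℤ) - 1) × M.GolycT t (k : ℤ)

/-- The divergence space on an element: `((w_T, w_T^c), (w_F)_F)`. -/
abbrev XdivT (t : M.Elem) : Type := DivT k t × (∀ f : M.facesT t, DivF k f.1)

variable (M) in
/-- The divergence space on the mesh: `((w_T, w_T^c)_T, (w_F)_F)`. -/
abbrev Xdiv : Type := (∀ t : M.Elem, DivT k t) × (∀ f : M.Face, DivF k f)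

/-- Restriction of the gradient space from a face to one of its edges. -/
def resGradFE (f : M.Face) (e : M.edgesF f) : XgradF B k f →ₗ[ℝ] XgradE k e.1 where
  toFun q := (q.2.1 e, fun v => q.2.2 ⟨v.1, M.mem_vertsF e.2 v.2⟩)
  map_add' _ _ := rfl
  map_smul' _ _ := rfl

/-- Restriction of the gradient space from an element to one of its faces. -/
def resGradTF (t : M.Elem) (f : M.facesT t) : XgradT B k t →ₗ[ℝ] XgradF B k f.1 where
  toFun q := (q.2.1 f, fun e => q.2.2.1 ⟨e.1, M.mem_edgesT f.2 e.2⟩,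
    fun v => q.2.2.2 ⟨v.1, M.mem_vertsT f.2 v.2⟩)
  map_add' _ _ := rfl
  map_smul' _ _ := rfl

/-- Restriction of the gradient space from the mesh to an edge. -/
def resGradE (e : M.Edge) : Xgrad B k →ₗ[ℝ] XgradE k e where
  toFun q := (q.2.2.1 e, fun v => q.2.2.2 v.1)
  map_add' _ _ := rfl
  map_smul' _ _ := rfl

/-- Restriction of the gradient space from the mesh to a face. -/
def resGradF (f : M.Face) : Xgrad B k →ₗ[ℝ] XgradF B k f where
  toFun q := (q.2.1 f, fun e => q.2.2.1 e.1, fun v => q.2.2.2 v.1)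
  map_add' _ _ := rfl
  map_smul' _ _ := rfl

/-- Restriction of the gradient space from the mesh to an element. -/
def resGradT (t : M.Elem) : Xgrad B k →ₗ[ℝ] XgradT B k t where
  toFun q := (q.1 t, fun f => q.2.1 f.1, fun e => q.2.2.1 e.1, fun v => q.2.2.2 v.1)
  map_add' _ _ := rfl
  map_smul' _ _ := rfl

/-- Restriction of the curl space from an element to one of its faces. -/
def resCurlTF (t : M.Elem) (f : M.facesT t) : XcurlT B k t →ₗ[ℝ] XcurlF B k f.1 where
  toFun v := (v.2.1 f, fun e => v.2.2 ⟨e.1, M.mem_edgesT f.2 e.2⟩)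
  map_add' _ _ := rfl
  map_smul' _ _ := rfl

/-- Restriction of the curl space from the mesh to a face. -/
def resCurlF (f : M.Face) : Xcurl B k →ₗ[ℝ] XcurlF B k f where
  toFun v := (v.2.1 f, fun e => v.2.2 e.1)
  map_add' _ _ := rfl
  map_smul' _ _ := rfl

/-- Restriction of the curl space from the mesh to an element. -/
def resCurlT (t : M.Elem) : Xcurl B k →ₗ[ℝ] XcurlT B k t where
  toFun v := (v.1 t, fun f => v.2.1 f.1, fun e => v.2.2 e.1)
  map_add' _ _ := rfl
  map_smul' _ _ := rfl

/-- Restriction of the divergence space from the mesh to an element. -/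
def resDivT (t : M.Elem) : Xdiv M k →ₗ[ℝ] XdivT k t where
  toFun w := (w.1 t, fun f => w.2 f.1)
  map_add' _ _ := rfl
  map_smul' _ _ := rfl

/-- Linear maps `X_grad(F) → 𝒫^k(F)²`. -/
abbrev SGradF (f : M.Face) : Type := XgradF B k f →ₗ[ℝ] vPolyOn (M.face f) (k : ℤ)

/-- Linear maps `X_curl(F) → 𝒫^k(F)²`. -/
abbrev SCurlF (f : M.Face) : Type := XcurlF B k f →ₗ[ℝ] vPolyOn (M.face f) (k : ℤ)

/-- Linear maps `X_grad(T) → 𝒫^k(T)³`. -/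
abbrev SGradT (t : M.Elem) : Type := XgradT B k t →ₗ[ℝ] vPolyOn (M.elem t) (k : ℤ)

/-- Linear maps `X_curl(T) → 𝒫^k(T)³`. -/
abbrev SCurlT (t : M.Elem) : Type := XcurlT B k t →ₗ[ℝ] vPolyOn (M.elem t) (k : ℤ)

/-- A choice of the serendipity gradients and curls on all faces and elements. Any linear maps
between the local spaces are allowed, so that every particular construction is covered; the usual
polynomially consistent one is `usualSerendipity` below. -/
structure SerendipityOps where
  gradF : ∀ f : M.Face, SGradF B k f
  curlF : ∀ f : M.Face, SCurlF B k f
  gradT : ∀ t : M.Elem, SGradT B k t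
  curlT : ∀ t : M.Elem, SCurlT B k t

variable {B k}

/-! ### Operators on the gradient space -/

/-- The edge gradient. -/
noncomputable def edgeGrad (e : M.Edge) : XgradE k e →ₗ[ℝ] polyOn (M.seg e) (k : ℤ) :=
  linSol fun q (G : polyOn (M.seg e) (k : ℤ)) => ∀ r ∈ polyOn (M.seg e) (k : ℤ),
    M.intE e (G * r) = -M.intE e (q.1 * dirDeriv (M.tangent e) r) +
      ∑ v, M.ωEV e v.1 * q.2 v * val (M.pos v.1) r

/-- The edge potential. -/
noncomputable def edgePot (e : M.Edge) : XgradE k e →ₗ[ℝ] polyOn (M.seg e) ((k : ℤ) + 1) :=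
  linSol fun q (γ : polyOn (M.seg e) ((k : ℤ) + 1)) =>
    (∀ v, val (M.pos v.1) γ = q.2 v) ∧
      projS (M.intE e) (polyOn (M.seg e) ((k : ℤ) - 1)) γ = q.1

/-- The face gradient. -/
noncomputable def faceGrad {f : M.Face} (s : SGradF B k f) :
    XgradF B k f →ₗ[ℝ] vPolyOn (M.face f) (k : ℤ) :=
  linSol fun q (G : vPolyOn (M.face f) (k : ℤ)) => ∀ w ∈ M.RolyF f k, ∀ τ ∈ M.RolycF f k,
    M.intF f (G ⬝ᵥ (w + τ)) =
      ∑ e, M.ωFE f e.1 *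
        M.intE e.1 (edgePot e.1 (resGradFE B k f e q) * (w ⬝ᵥ cst (M.normalFE f e.1))) +
      M.intF f (s q ⬝ᵥ τ)

/-- The face scalar potential. -/
noncomputable def facePot {f : M.Face} (s : SGradF B k f) :
    XgradF B k f →ₗ[ℝ] polyOn (M.face f) ((k : ℤ) + 1) :=
  linSol fun q (γ : polyOn (M.face f) ((k : ℤ) + 1)) => ∀ w ∈ M.RolycF f ((k : ℤ) + 2),
    M.intF f (γ * dvg w) = -M.intF f (faceGrad s q ⬝ᵥ w) +
      ∑ e, M.ωFE f e.1 *
        M.intE e.1 (edgePot e.1 (resGradFE B k f e q) * (w ⬝ᵥ cst (M.normalFE f e.1)))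

/-- The element gradient. -/
noncomputable def elemGrad (sF : ∀ f, SGradF B k f) {t : M.Elem} (s : SGradT B k t) :
    XgradT B k t →ₗ[ℝ] vPolyOn (M.elem t) (k : ℤ) :=
  linSol fun q (G : vPolyOn (M.elem t) (k : ℤ)) => ∀ w ∈ M.RolyT t k, ∀ τ ∈ M.RolycT t k,
    M.intT t (G ⬝ᵥ (w + τ)) =
      ∑ f, M.ωTF t f.1 *
        M.intF f.1 (facePot (sF f.1) (resGradTF B k t f q) * (w ⬝ᵥ cst (M.normal f.1))) +
      M.intT t (s q ⬝ᵥ τ)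

/-- The element scalar potential `P_grad`. -/
noncomputable def elemPot (sF : ∀ f, SGradF B k f) {t : M.Elem} (s : SGradT B k t) :
    XgradT B k t →ₗ[ℝ] polyOn (M.elem t) ((k : ℤ) + 1) :=
  linSol fun q (P : polyOn (M.elem t) ((k : ℤ) + 1)) => ∀ w ∈ M.RolycT t ((k : ℤ) + 2),
    M.intT t (P * dvg w) = -M.intT t (elemGrad sF s q ⬝ᵥ w) +
      ∑ f, M.ωTF t f.1 *
        M.intF f.1 (facePot (sF f.1) (resGradTF B k t f q) * (w ⬝ᵥ cst (M.normal f.1)))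

/-! ### Operators on the curl space -/

variable (B k) in
/-- The face curl. -/
noncomputable def faceCurl (f : M.Face) : XcurlF B k f →ₗ[ℝ] polyOn (M.face f) (k : ℤ) :=
  linSol fun v (c : polyOn (M.face f) (k : ℤ)) => ∀ r ∈ polyOn (M.face f) (k : ℤ),
    M.intF f (c * r) = M.intF f (v.1.1 ⬝ᵥ vrot (M.normal f) r) -
      ∑ e, M.ωFE f e.1 * M.intE e.1 (v.2 e * r)

/-- The face tangential potential. -/
noncomputable def faceTan {f : M.Face} (s : SCurlF B k f) :
    XcurlF B k f →ₗ[ℝ] vPolyOn (M.face f) (k : ℤ) :=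
  linSol fun v (γ : vPolyOn (M.face f) (k : ℤ)) =>
    ∀ r ∈ polyOn (M.face f) ((k : ℤ) + 1), M.intF f r = 0 → ∀ τ ∈ M.RolycF f k,
      M.intF f (γ ⬝ᵥ (vrot (M.normal f) r + τ)) = M.intF f (faceCurl B k f v * r) +
        ∑ e, M.ωFE f e.1 * M.intE e.1 (v.2 e * r) + M.intF f (s v ⬝ᵥ τ)

/-- The element curl. -/
noncomputable def elemCurl (sF : ∀ f, SCurlF B k f) (t : M.Elem) :
    XcurlT B k t →ₗ[ℝ] vPolyOn (M.elem t) (k : ℤ) :=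
  linSol fun v (c : vPolyOn (M.elem t) (k : ℤ)) => ∀ w ∈ vPolyOn (M.elem t) (k : ℤ),
    M.intT t (c ⬝ᵥ w) = M.intT t (v.1.1 ⬝ᵥ curl w) +
      ∑ f, M.ωTF t f.1 *
        M.intF f.1 (faceTan (sF f.1) (resCurlTF B k t f v) ⬝ᵥ (w ⨯₃ cst (M.normal f.1)))

/-- The element vector potential `P_curl`. -/
noncomputable def elemVec (sF : ∀ f, SCurlF B k f) {t : M.Elem} (s : SCurlT B k t) :
    XcurlT B k t →ₗ[ℝ] vPolyOn (M.elem t) (k : ℤ) :=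
  linSol fun v (P : vPolyOn (M.elem t) (k : ℤ)) =>
    ∀ w ∈ M.GolycT t ((k : ℤ) + 1), ∀ τ ∈ M.RolycT t k,
      M.intT t (P ⬝ᵥ (curl w + τ)) = M.intT t (elemCurl sF t v ⬝ᵥ w) -
        ∑ f, M.ωTF t f.1 *
          M.intF f.1 (faceTan (sF f.1) (resCurlTF B k t f v) ⬝ᵥ (w ⨯₃ cst (M.normal f.1))) +
        M.intT t (s v ⬝ᵥ τ)

/-! ### Operators on the divergence space -/

variable (k) in
/-- The element divergence. -/
noncomputable def elemDiv (t : M.Elem) : XdivT k t →ₗ[ℝ] polyOn (M.elem t) (k : ℤ) :=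
  linSol fun w (d : polyOn (M.elem t) (k : ℤ)) => ∀ q ∈ polyOn (M.elem t) (k : ℤ),
    M.intT t (d * q) = -M.intT t (w.1.1 ⬝ᵥ grad q) +
      ∑ f, M.ωTF t f.1 * M.intF f.1 (w.2 f * q)

variable (k) in
/-- The element vector potential `P_div`. -/
noncomputable def elemDivPot (t : M.Elem) : XdivT k t →ₗ[ℝ] vPolyOn (M.elem t) (k : ℤ) :=
  linSol fun w (P : vPolyOn (M.elem t) (k : ℤ)) =>
    ∀ r ∈ polyOn (M.elem t) ((k : ℤ) + 1), M.intT t r = 0 → ∀ τ ∈ M.GolycT t k,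
      M.intT t (P ⬝ᵥ (grad r + τ)) = -M.intT t (elemDiv k t w * r) +
        ∑ f, M.ωTF t f.1 * M.intF f.1 (w.2 f * r) + M.intT t (w.1.2 ⬝ᵥ τ)

/-! ### The usual serendipity operators

They reconstruct a gradient (resp. a vector field) with prescribed projection on `ℛ^{c,ℓ_P+1}(P)`
whose curl and tangential traces fit those of the data in the least square sense; the constraint is
imposed by a Lagrange multiplier `ζ`. -/

variable (B k) in
/-- The usual serendipity gradient on a face. -/
noncomputable def usualGradF (f : M.Face) : SGradF B k f :=
  linSol fun q (σ : vPolyOn (M.face f) (k : ℤ)) => ∃ ζ ∈ M.RolycF f (degF B k f + 1),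
    (∀ τ ∈ vPolyOn (M.face f) (k : ℤ),
      Metric.diam (M.face f) ^ 2 *
          M.intF f (srot (M.normal f) σ * srot (M.normal f) τ) +
        Metric.diam (M.face f) * ∑ e : M.edgesF f,
          M.intE e.1 ((σ ⬝ᵥ cst (M.tangent e.1)) * (τ ⬝ᵥ cst (M.tangent e.1))) +
        M.intF f (ζ ⬝ᵥ τ) =
      Metric.diam (M.face f) * ∑ e : M.edgesF f,
        M.intE e.1 (edgeGrad e.1 (resGradFE B k f e q) * (τ ⬝ᵥ cst (M.tangent e.1)))) ∧
    ∀ μ ∈ M.RolycF f (degF B k f + 1),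
      M.intF f (σ ⬝ᵥ μ) = -M.intF f (q.1 * dvg μ) + ∑ e, M.ωFE f e.1 *
        M.intE e.1 (edgePot e.1 (resGradFE B k f e q) * (μ ⬝ᵥ cst (M.normalFE f e.1)))

variable (B k) in
/-- The usual serendipity curl operator on a face. -/
noncomputable def usualCurlF (f : M.Face) : SCurlF B k f :=
  linSol fun v (σ : vPolyOn (M.face f) (k : ℤ)) => ∃ ζ ∈ M.RolycF f (degF B k f + 1),
    (∀ τ ∈ vPolyOn (M.face f) (k : ℤ),
      Metric.diam (M.face f) ^ 2 *
          M.intF f (srot (M.normal f) σ * srot (M.normal f) τ) +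
        Metric.diam (M.face f) * ∑ e : M.edgesF f,
          M.intE e.1 ((σ ⬝ᵥ cst (M.tangent e.1)) * (τ ⬝ᵥ cst (M.tangent e.1))) +
        M.intF f (ζ ⬝ᵥ τ) =
      Metric.diam (M.face f) ^ 2 *
          M.intF f (faceCurl B k f v * srot (M.normal f) τ) +
        Metric.diam (M.face f) * ∑ e : M.edgesF f,
          M.intE e.1 (v.2 e * (τ ⬝ᵥ cst (M.tangent e.1)))) ∧
    ∀ μ ∈ M.RolycF f (degF B k f + 1), M.intF f (σ ⬝ᵥ μ) = M.intF f (v.1.2 ⬝ᵥ μ)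

variable (B k) in
/-- The usual serendipity gradient on an element. -/
noncomputable def usualGradT (t : M.Elem) : SGradT B k t :=
  linSol fun q (σ : vPolyOn (M.elem t) (k : ℤ)) => ∃ ζ ∈ M.RolycT t (degT B k t + 1),
    (∀ τ ∈ vPolyOn (M.elem t) (k : ℤ),
      Metric.diam (M.elem t) ^ 2 * M.intT t (curl σ ⬝ᵥ curl τ) +
        Metric.diam (M.elem t) * ∑ f : M.facesT t,
          M.intF f.1 (tang (M.normal f.1) σ ⬝ᵥ tang (M.normal f.1) τ) +
        M.intT t (ζ ⬝ᵥ τ) =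
      Metric.diam (M.elem t) * ∑ f : M.facesT t,
        M.intF f.1 (faceGrad (usualGradF B k f.1) (resGradTF B k t f q) ⬝ᵥ
          tang (M.normal f.1) τ)) ∧
    ∀ μ ∈ M.RolycT t (degT B k t + 1),
      M.intT t (σ ⬝ᵥ μ) = -M.intT t (q.1 * dvg μ) + ∑ f, M.ωTF t f.1 *
        M.intF f.1 (facePot (usualGradF B k f.1) (resGradTF B k t f q) *
          (μ ⬝ᵥ cst (M.normal f.1)))

variable (B k) in
/-- The usual serendipity curl operator on an element. -/
noncomputable def usualCurlT (t : M.Elem) : SCurlT B k t :=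
  linSol fun v (σ : vPolyOn (M.elem t) (k : ℤ)) => ∃ ζ ∈ M.RolycT t (degT B k t + 1),
    (∀ τ ∈ vPolyOn (M.elem t) (k : ℤ),
      Metric.diam (M.elem t) ^ 2 * M.intT t (curl σ ⬝ᵥ curl τ) +
        Metric.diam (M.elem t) * ∑ f : M.facesT t,
          M.intF f.1 (tang (M.normal f.1) σ ⬝ᵥ tang (M.normal f.1) τ) +
        M.intT t (ζ ⬝ᵥ τ) =
      Metric.diam (M.elem t) ^ 2 *
          M.intT t (elemCurl (usualCurlF B k) t v ⬝ᵥ curl τ) +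
        Metric.diam (M.elem t) * ∑ f : M.facesT t,
          M.intF f.1 (faceTan (usualCurlF B k f.1) (resCurlTF B k t f v) ⬝ᵥ
            tang (M.normal f.1) τ)) ∧
    ∀ μ ∈ M.RolycT t (degT B k t + 1), M.intT t (σ ⬝ᵥ μ) = M.intT t (v.1.2 ⬝ᵥ μ)

variable (B k) in
/-- The usual serendipity operators. -/
noncomputable def usualSerendipity : SerendipityOps B k where
  gradF := usualGradF B k
  curlF := usualCurlF B k
  gradT := usualGradT B k
  curlT := usualCurlT B k

/-! ### Discrete operators and inner products on the mesh -/

variable (S : SerendipityOps B k)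

/-- The discrete gradient. -/
noncomputable def discGrad : Xgrad B k →ₗ[ℝ] Xcurl B k :=
  (LinearMap.pi fun t =>
    ((projV (M.intT t) (M.RolyT t ((k : ℤ) - 1))).prod
      (projV (M.intT t) (M.RolycT t (degT B k t + 1)))) ∘ₗ
        (vPolyOn (M.elem t) (k : ℤ)).subtype ∘ₗ elemGrad S.gradF (S.gradT t) ∘ₗ
          resGradT B k t).prod
  ((LinearMap.pi fun f =>
    ((projV (M.intF f) (M.RolyF f ((k : ℤ) - 1))).prod
      (projV (M.intF f) (M.RolycF f (degF B k f + 1)))) ∘ₗ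
        (vPolyOn (M.face f) (k : ℤ)).subtype ∘ₗ faceGrad (S.gradF f) ∘ₗ
          resGradF B k f).prod
  (LinearMap.pi fun e => edgeGrad e ∘ₗ resGradE B k e))

/-- The discrete curl. -/
noncomputable def discCurl : Xcurl B k →ₗ[ℝ] Xdiv M k :=
  (LinearMap.pi fun t =>
    ((projV (M.intT t) (M.GolyT t ((k : ℤ) - 1))).prod
      (projV (M.intT t) (M.GolycT t (k : ℤ)))) ∘ₗ
        (vPolyOn (M.elem t) (k : ℤ)).subtype ∘ₗ elemCurl S.curlF t ∘ₗ
          resCurlT B k t).prod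
  (LinearMap.pi fun f => faceCurl B k f ∘ₗ resCurlF B k f)

/-- The piecewise polynomial scalar potential on the mesh. -/
noncomputable def potGrad : Xgrad B k →ₗ[ℝ] (M.Elem → Pol) :=
  LinearMap.pi fun t =>
    (polyOn (M.elem t) ((k : ℤ) + 1)).subtype ∘ₗ elemPot S.gradF (S.gradT t) ∘ₗ resGradT B k t

/-- The piecewise polynomial vector potential on the mesh. -/
noncomputable def potCurl : Xcurl B k →ₗ[ℝ] (M.Elem → VPol) :=
  LinearMap.pi fun t =>
    (vPolyOn (M.elem t) (k : ℤ)).subtype ∘ₗ elemVec S.curlF (S.curlT t) ∘ₗ resCurlT B k t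

/-- The piecewise polynomial curl on the mesh. -/
noncomputable def pwCurl : Xcurl B k →ₗ[ℝ] (M.Elem → VPol) :=
  LinearMap.pi fun t =>
    (vPolyOn (M.elem t) (k : ℤ)).subtype ∘ₗ elemCurl S.curlF t ∘ₗ resCurlT B k t

/-- The discrete `L²`-product on the curl space of an element (with its stabilisation). -/
noncomputable def innerCurlT (t : M.Elem) : LinearMap.BilinForm ℝ (XcurlT B k t) :=
  let P : XcurlT B k t →ₗ[ℝ] VPol :=
    (vPolyOn (M.elem t) (k : ℤ)).subtype ∘ₗ elemVec S.curlF (S.curlT t)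
  let dF (f : M.facesT t) : XcurlT B k t →ₗ[ℝ] VPol := tang (M.normal f.1) ∘ₗ P -
    (vPolyOn (M.face f.1) (k : ℤ)).subtype ∘ₗ faceTan (S.curlF f.1) ∘ₗ resCurlTF B k t f
  let dE (e : M.edgesT t) : XcurlT B k t →ₗ[ℝ] Pol := dot (cst (M.tangent e.1)) ∘ₗ P -
    (polyOn (M.seg e.1) (k : ℤ)).subtype ∘ₗ LinearMap.proj e ∘ₗ LinearMap.snd ℝ _ _ ∘ₗ
      LinearMap.snd ℝ _ _
  (l2V (M.intT t)).comp P P +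
    (∑ f : M.facesT t, Metric.diam (M.face f.1) • (l2V (M.intF f.1)).comp (dF f) (dF f) +
      ∑ e : M.edgesT t, Metric.diam (M.seg e.1) ^ 2 • (l2S (M.intE e.1)).comp (dE e) (dE e))

/-- The discrete `L²`-product on the divergence space of an element (with its stabilisation). -/
noncomputable def innerDivT (t : M.Elem) : LinearMap.BilinForm ℝ (XdivT k t) :=
  let P : XdivT k t →ₗ[ℝ] VPol := (vPolyOn (M.elem t) (k : ℤ)).subtype ∘ₗ elemDivPot k t
  let dF (f : M.facesT t) : XdivT k t →ₗ[ℝ] Pol := dot (cst (M.normal f.1)) ∘ₗ P -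
    (polyOn (M.face f.1) (k : ℤ)).subtype ∘ₗ LinearMap.proj f ∘ₗ LinearMap.snd ℝ _ _
  (l2V (M.intT t)).comp P P +
    ∑ f : M.facesT t, Metric.diam (M.face f.1) • (l2S (M.intF f.1)).comp (dF f) (dF f)

/-- The discrete `L²`-product on the curl space. -/
noncomputable def innerCurl : LinearMap.BilinForm ℝ (Xcurl B k) :=
  ∑ t, (innerCurlT S t).comp (resCurlT B k t) (resCurlT B k t)

variable (M k) in
/-- The discrete `L²`-product on the divergence space. -/
noncomputable def innerDiv : LinearMap.BilinForm ℝ (Xdiv M k) :=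
  ∑ t, (innerDivT t).comp (resDivT k t) (resDivT k t)

variable (M) in
/-- The `L²`-product of piecewise polynomial vector fields over the domain, which is the union of
the elements, up to overlaps of measure zero. -/
noncomputable def innerL2 : LinearMap.BilinForm ℝ (M.Elem → VPol) :=
  ∑ t, (l2V (M.intT t)).comp (LinearMap.proj t) (LinearMap.proj t)

variable (M) in
/-- Product of a piecewise polynomial vector field and a scalar one. -/
noncomputable def pwScal : (M.Elem → VPol) →ₗ[ℝ] (M.Elem → Pol) →ₗ[ℝ] (M.Elem → VPol) :=
  LinearMap.mk₂ ℝ (fun v p t => scal (v t) (p t)) (by intros; ext1; simp)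
    (by intros; ext1; simp) (by intros; ext1; simp) (by intros; ext1; simp)

variable (M) in
/-- Cross product of piecewise polynomial vector fields. -/
noncomputable def pwCross : (M.Elem → VPol) →ₗ[ℝ] (M.Elem → VPol) →ₗ[ℝ] (M.Elem → VPol) :=
  LinearMap.mk₂ ℝ (fun v w t => cross (v t) (w t)) (by intros; ext1; simp)
    (by intros; ext1; simp) (by intros; ext1; simp) (by intros; ext1; simp)

/-- The discrete cross product `X_curl × X_curl → X_div`, obtained by projecting on the components
of `X_div` the cross products of the element vector potentials and the normal components of the
cross products of the face tangential potentials. -/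
noncomputable def discCross : Xcurl B k →ₗ[ℝ] Xcurl B k →ₗ[ℝ] Xdiv M k :=
  let P (t : M.Elem) : Xcurl B k →ₗ[ℝ] VPol := LinearMap.proj t ∘ₗ potCurl S
  let γ (f : M.Face) : Xcurl B k →ₗ[ℝ] VPol :=
    (vPolyOn (M.face f) (k : ℤ)).subtype ∘ₗ faceTan (S.curlF f) ∘ₗ resCurlF B k f
  LinearMap.mk₂ ℝ (fun v w =>
    (fun t => (projV (M.intT t) (M.GolyT t ((k : ℤ) - 1)) (cross (P t v) (P t w)),
      projV (M.intT t) (M.GolycT t (k : ℤ)) (cross (P t v) (P t w))),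
    fun f => projS (M.intF f) (polyOn (M.face f) (k : ℤ))
      (dot (cst (M.normal f)) (cross (γ f v) (γ f w)))))
    (by intros; ext1 <;> ext1 <;> simp)
    (by intros; ext1 <;> ext1 <;> simp)
    (by intros; ext1 <;> ext1 <;> simp)
    (by intros; ext1 <;> ext1 <;> simp)

end SDDR

/-! ## Lie algebra-valued objects and the schemes -/

section Lie

variable {M : PolyMesh} {B : BoundarySelection M} {k : ℕ} (S : SerendipityOps B k)
variable {𝔤 : Type*} [LieRing 𝔤] [LieAlgebra ℝ 𝔤] (ip : LinearMap.BilinForm ℝ 𝔤)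

variable (𝔤) in
/-- The bracket of a Lie algebra as a bilinear map. -/
def lieMap : 𝔤 →ₗ[ℝ] 𝔤 →ₗ[ℝ] 𝔤 :=
  LinearMap.mk₂ ℝ (fun a b => ⁅a, b⁆) add_lie smul_lie lie_add lie_smul

variable (M 𝔤) in
/-- The bracket `[v ⊗ a, q ⊗ b] = v q ⊗ [a, b]` of a vector field and a scalar field. -/
noncomputable def bktVS : (M.Elem → VPol) ⊗[ℝ] 𝔤 →ₗ[ℝ] (M.Elem → Pol) ⊗[ℝ] 𝔤 →ₗ[ℝ]
    (M.Elem → VPol) ⊗[ℝ] 𝔤 :=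
  TensorProduct.map₂ (pwScal M) (lieMap 𝔤)

variable (M 𝔤) in
/-- The bracket `⋆[v ⊗ a, w ⊗ b] = (v × w) ⊗ [a, b]` of two vector fields. -/
noncomputable def bktVV : (M.Elem → VPol) ⊗[ℝ] 𝔤 →ₗ[ℝ] (M.Elem → VPol) ⊗[ℝ] 𝔤 →ₗ[ℝ]
    (M.Elem → VPol) ⊗[ℝ] 𝔤 :=
  TensorProduct.map₂ (pwCross M) (lieMap 𝔤)

variable (𝔤) in
/-- The discrete version of the bracket of two vector fields, with values in the Lie algebra-valued
divergence space. -/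
noncomputable def bktDisc : Xcurl B k ⊗[ℝ] 𝔤 →ₗ[ℝ] Xcurl B k ⊗[ℝ] 𝔤 →ₗ[ℝ] Xdiv M k ⊗[ℝ] 𝔤 :=
  TensorProduct.map₂ (discCross S) (lieMap 𝔤)

/-- The inner product of the Lie algebra-valued curl space. -/
noncomputable def innerCurlG : LinearMap.BilinForm ℝ (Xcurl B k ⊗[ℝ] 𝔤) :=
  LinearMap.BilinForm.tmul (innerCurl S) ip

variable (M k) in
/-- The inner product of the Lie algebra-valued divergence space. -/
noncomputable def innerDivG : LinearMap.BilinForm ℝ (Xdiv M k ⊗[ℝ] 𝔤) :=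
  LinearMap.BilinForm.tmul (innerDiv M k) ip

variable (M) in
/-- The integral `∫ ⟨v, w⟩` of Lie algebra-valued piecewise polynomial vector fields. -/
noncomputable def innerL2G : LinearMap.BilinForm ℝ ((M.Elem → VPol) ⊗[ℝ] 𝔤) :=
  LinearMap.BilinForm.tmul (innerL2 M) ip

variable (𝔤) in
/-- The Lie algebra-valued discrete gradient. -/
noncomputable def discGradG : Xgrad B k ⊗[ℝ] 𝔤 →ₗ[ℝ] Xcurl B k ⊗[ℝ] 𝔤 :=
  (discGrad S).rTensor 𝔤

variable (𝔤) in
/-- The Lie algebra-valued discrete curl. -/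
noncomputable def discCurlG : Xcurl B k ⊗[ℝ] 𝔤 →ₗ[ℝ] Xdiv M k ⊗[ℝ] 𝔤 :=
  (discCurl S).rTensor 𝔤

variable (𝔤) in
/-- The Lie algebra-valued piecewise polynomial scalar potential. -/
noncomputable def potGradG : Xgrad B k ⊗[ℝ] 𝔤 →ₗ[ℝ] (M.Elem → Pol) ⊗[ℝ] 𝔤 :=
  (potGrad S).rTensor 𝔤

variable (𝔤) in
/-- The Lie algebra-valued piecewise polynomial vector potential. -/
noncomputable def potCurlG : Xcurl B k ⊗[ℝ] 𝔤 →ₗ[ℝ] (M.Elem → VPol) ⊗[ℝ] 𝔤 :=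
  (potCurl S).rTensor 𝔤

variable (𝔤) in
/-- The Lie algebra-valued piecewise polynomial curl. -/
noncomputable def pwCurlG : Xcurl B k ⊗[ℝ] 𝔤 →ₗ[ℝ] (M.Elem → VPol) ⊗[ℝ] 𝔤 :=
  (pwCurl S).rTensor 𝔤

/-- The two discretisations of the nonlinear terms. -/
inductive NonlinearChoice
  | N1
  | N2

/-- The nonlinear term `𝔑(A, A'; v)`, for `A` and `A'` the potentials at two successive times. -/
noncomputable def nonlin : NonlinearChoice →
    Xcurl B k ⊗[ℝ] 𝔤 → Xcurl B k ⊗[ℝ] 𝔤 → Xcurl B k ⊗[ℝ] 𝔤 → ℝ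
  | .N1, A, A', v =>
    let Am := (1 / 2 : ℝ) • (A + A')
    innerDivG M k ip (discCurlG S 𝔤 A') (bktDisc S 𝔤 Am v) +
      innerDivG M k ip ((1 / 2 : ℝ) • bktDisc S 𝔤 A' A') (discCurlG S 𝔤 v + bktDisc S 𝔤 Am v)
  | .N2, A, A', v =>
    let Am := (1 / 2 : ℝ) • (A + A')
    let P := potCurlG S 𝔤
    innerL2G M ip (pwCurlG S 𝔤 A') (bktVV M 𝔤 (P Am) (P v)) +
      innerL2G M ip ((1 / 2 : ℝ) • bktVV M 𝔤 (P A') (P A'))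
        (pwCurlG S 𝔤 v + bktVV M 𝔤 (P Am) (P v))

/-- The discrete time derivative `δ_t^{n+1} v`. -/
noncomputable def dt {X : Type*} [AddCommGroup X] [Module ℝ X] {N : ℕ} (τ : Fin (N + 1) → ℝ)
    (v : Fin (N + 1) → X) (n : Fin N) : X :=
  (τ n.succ - τ n.castSucc)⁻¹ • (v n.succ - v n.castSucc)

/-- The families `A`, `E`, `lam` solve the constrained scheme on the time grid `τ`. -/
structure IsSolution (c : NonlinearChoice) {N : ℕ} (τ : Fin (N + 1) → ℝ)
    (A E : Fin (N + 1) → Xcurl B k ⊗[ℝ] 𝔤) (lam : Fin (N + 1) → Xgrad B k ⊗[ℝ] 𝔤) : Prop where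
  potential_eq : ∀ n : Fin N, dt τ A n = -E n.succ
  field_eq : ∀ n : Fin N, ∀ v : Xcurl B k ⊗[ℝ] 𝔤,
    innerCurlG S ip (dt τ E n) v + innerCurlG S ip (discGradG S 𝔤 (lam n.succ)) v +
      innerL2G M ip (bktVS M 𝔤 (potCurlG S 𝔤 (A n.succ)) (potGradG S 𝔤 (lam n.succ)))
        (potCurlG S 𝔤 v) =
    innerDivG M k ip (discCurlG S 𝔤 (A n.succ)) (discCurlG S 𝔤 v) +
      nonlin S ip c (A n.castSucc) (A n.succ) v
  constraint_eq : ∀ n : Fin N, ∀ q : Xgrad B k ⊗[ℝ] 𝔤,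
    innerCurlG S ip (dt τ E n) (discGradG S 𝔤 q) +
      innerL2G M ip (potCurlG S 𝔤 (dt τ E n))
        (bktVS M 𝔤 (potCurlG S 𝔤 (A n.castSucc)) (potGradG S 𝔤 q)) = 0

/-- The constraint functional of a potential `A` and an electric field `E`. -/
noncomputable def constraint (A E : Xcurl B k ⊗[ℝ] 𝔤) (q : Xgrad B k ⊗[ℝ] 𝔤) : ℝ :=
  innerCurlG S ip E (discGradG S 𝔤 q) +
    innerL2G M ip (potCurlG S 𝔤 E) (bktVS M 𝔤 (potCurlG S 𝔤 A) (potGradG S 𝔤 q))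

end Lie

end YMDDR

/-!
Ad-invariance of the inner product makes each bracket operator `[·, p]` skew-adjoint, so
`∫ ⟨v, [v, p]⟩` vanishes for every `v`. Over a time step `A` moves in the direction of the new `E`;
hence replacing the old `A` by the new one does not change the constraint functional at the new `E`.
For fixed `A` this functional is linear in `E`, and the third equation of the scheme says that it
vanishes at `δE` for the old `A`.
-/

namespace YMDDR

open TensorProduct

section BilinearForms

variable {R : Type*} [CommRing R]

theorem apply_lie_eq_neg_apply_lie {L : Type*} [LieRing L] [Module R L]
    {Φ : LinearMap.BilinForm R L} (hsymm : Φ.IsSymm) (hinv : Φ.lieInvariant L) (a b c : L) :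
    Φ a ⁅b, c⁆ = -Φ b ⁅a, c⁆ :=
  calc Φ a ⁅b, c⁆
    _ = -Φ a ⁅c, b⁆ := by rw [← lie_skew, map_neg]
    _ = Φ ⁅c, a⁆ b := (hinv c a b).symm
    _ = Φ b ⁅c, a⁆ := hsymm.eq _ _
    _ = -Φ b ⁅a, c⁆ := by rw [← lie_skew, map_neg]

theorem tmul_map₂_eq_neg {V P L Q : Type*} [AddCommMonoid V] [Module R V] [AddCommMonoid P]
    [Module R P] [AddCommMonoid L] [Module R L] [AddCommMonoid Q] [Module R Q]
    {β : LinearMap.BilinForm R V} {Φ : LinearMap.BilinForm R L}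
    {f : V →ₗ[R] P →ₗ[R] V} {g : L →ₗ[R] Q →ₗ[R] L}
    (hf : ∀ v w p, β v (f w p) = β w (f v p)) (hg : ∀ a b c, Φ a (g b c) = -Φ b (g a c))
    (x y : V ⊗[R] L) (z : P ⊗[R] Q) :
    LinearMap.BilinForm.tmul β Φ x (map₂ f g y z) =
      -LinearMap.BilinForm.tmul β Φ y (map₂ f g x z) := by
  induction z with
  | zero => simp only [map_zero, neg_zero]
  | add z z' hz hz' => simp only [map_add, hz, hz', neg_add]
  | tmul p c =>
    induction x with
    | zero => simp only [map_zero, LinearMap.zero_apply, neg_zero]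
    | add x x' hx hx' => simp only [map_add, LinearMap.add_apply, hx, hx', neg_add]
    | tmul v a =>
      induction y with
      | zero => simp only [map_zero, LinearMap.zero_apply, neg_zero]
      | add y y' hy hy' => simp only [map_add, LinearMap.add_apply, hy, hy', neg_add]
      | tmul w b =>
        simp only [map₂_apply_tmul, map_tmul, LinearMap.BilinForm.tensorDistrib_tmul, hf v w p,
          hg a b c, neg_smul]

end BilinearForms

section TimeDerivative

variable {X : Type*} [AddCommGroup X] [Module ℝ X] {N : ℕ} {τ : Fin (N + 1) → ℝ} {n : Fin N}

theorem succ_eq_add_smul_dt (hτ : τ n.castSucc ≠ τ n.succ) (v : Fin (N + 1) → X) :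
    v n.succ = v n.castSucc + (τ n.succ - τ n.castSucc) • dt τ v n := by
  rw [dt, smul_inv_smul₀ (sub_ne_zero.2 hτ.symm), add_sub_cancel]

theorem succ_eq_add_smul_of_dt_eq_neg (hτ : τ n.castSucc ≠ τ n.succ) {v : Fin (N + 1) → X} {w : X}
    (hv : dt τ v n = -w) : v n.succ = v n.castSucc + (τ n.castSucc - τ n.succ) • w := by
  rw [succ_eq_add_smul_dt hτ v, hv, smul_neg, ← neg_smul, neg_sub]

end TimeDerivative

theorem innerL2_pwScal_comm {M : PolyMesh} (v w : M.Elem → VPol) (p : M.Elem → Pol) :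
    innerL2 M v (pwScal M w p) = innerL2 M w (pwScal M v p) := by
  simp [innerL2, pwScal, scal, l2V, dot, dotProduct_comm]

section Constraint

variable {M : PolyMesh} {𝔤 : Type*} [LieRing 𝔤] [LieAlgebra ℝ 𝔤] {ip : LinearMap.BilinForm ℝ 𝔤}

theorem innerL2G_bktVS_self (ip_symm : ip.IsSymm) (ip_invariant : ip.lieInvariant 𝔤)
    (v : (M.Elem → VPol) ⊗[ℝ] 𝔤) (p : (M.Elem → Pol) ⊗[ℝ] 𝔤) :
    innerL2G M ip v (bktVS M 𝔤 v p) = 0 :=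
  self_eq_neg.1 <|
    tmul_map₂_eq_neg innerL2_pwScal_comm (apply_lie_eq_neg_apply_lie ip_symm ip_invariant) v v p

variable {B : BoundarySelection M} {k : ℕ} (S : SerendipityOps B k)

theorem constraint_add_smul_self (ip_symm : ip.IsSymm) (ip_invariant : ip.lieInvariant 𝔤)
    (A E : Xcurl B k ⊗[ℝ] 𝔤) (r : ℝ) (q : Xgrad B k ⊗[ℝ] 𝔤) :
    constraint S ip (A + r • E) E q = constraint S ip A E q := by
  simp only [constraint, map_add, map_smul, LinearMap.add_apply, LinearMap.smul_apply,
    innerL2G_bktVS_self ip_symm ip_invariant, smul_zero, add_zero]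

theorem constraint_add_smul (ip : LinearMap.BilinForm ℝ 𝔤) (A E F : Xcurl B k ⊗[ℝ] 𝔤) (r : ℝ)
    (q : Xgrad B k ⊗[ℝ] 𝔤) :
    constraint S ip A (E + r • F) q = constraint S ip A E q + r * constraint S ip A F q := by
  simp only [constraint, map_add, map_smul, LinearMap.add_apply, LinearMap.smul_apply,
    smul_eq_mul]
  ring

theorem constraint_succ (ip_symm : ip.IsSymm) (ip_invariant : ip.lieInvariant 𝔤) {N : ℕ}
    {τ : Fin (N + 1) → ℝ} {A E : Fin (N + 1) → Xcurl B k ⊗[ℝ] 𝔤} {q : Xgrad B k ⊗[ℝ] 𝔤} {n : Fin N}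
    (hτ : τ n.castSucc ≠ τ n.succ) (hA : dt τ A n = -E n.succ)
    (hE : constraint S ip (A n.castSucc) (dt τ E n) q = 0) :
    constraint S ip (A n.succ) (E n.succ) q = constraint S ip (A n.castSucc) (E n.castSucc) q :=
  calc constraint S ip (A n.succ) (E n.succ) q
    _ = constraint S ip (A n.castSucc + (τ n.castSucc - τ n.succ) • E n.succ) (E n.succ) q := by
      rw [succ_eq_add_smul_of_dt_eq_neg hτ hA]
    _ = constraint S ip (A n.castSucc) (E n.succ) q :=
      constraint_add_smul_self S ip_symm ip_invariant ..
    _ = constraint S ip (A n.castSucc) (E n.castSucc) q := by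
      rw [succ_eq_add_smul_dt hτ E, constraint_add_smul, hE, mul_zero, add_zero]

end Constraint

end YMDDR

open YMDDR TensorProduct in
theorem proposition1_general {M : PolyMesh} {B : BoundarySelection M} {k : ℕ}
    (S : SerendipityOps B k) {𝔤 : Type*} [LieRing 𝔤] [LieAlgebra ℝ 𝔤]
    {ip : LinearMap.BilinForm ℝ 𝔤} (ip_symm : ip.IsSymm) (ip_invariant : ip.lieInvariant 𝔤)
    {N : ℕ} {τ : Fin (N + 1) → ℝ} (hτ : ∀ n : Fin N, τ n.castSucc ≠ τ n.succ)
    {A E : Fin (N + 1) → Xcurl B k ⊗[ℝ] 𝔤} {q : Xgrad B k ⊗[ℝ] 𝔤}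
    (hA : ∀ n : Fin N, dt τ A n = -E n.succ)
    (hE : ∀ n : Fin N, constraint S ip (A n.castSucc) (dt τ E n) q = 0) (m n : Fin (N + 1)) :
    constraint S ip (A m) (E m) q = constraint S ip (A n) (E n) q := by
  have eq_initial (j) : constraint S ip (A j) (E j) q = constraint S ip (A 0) (E 0) q := by
    induction j using Fin.induction with
    | zero => rfl
    | succ i ih => rw [constraint_succ S ip_symm ip_invariant (hτ i) (hA i) (hE i), ih]
  rw [eq_initial m, eq_initial n]

open YMDDR TensorProduct in
theorem proposition1 {M : PolyMesh} {B : BoundarySelection M} {k : ℕ} (S : SerendipityOps B k)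
    {𝔤 : Type*} [LieRing 𝔤] [LieAlgebra ℝ 𝔤] [FiniteDimensional ℝ 𝔤]
    (ip : LinearMap.BilinForm ℝ 𝔤) (ip_symm : ip.IsSymm) (ip_pos : ∀ x, x ≠ 0 → 0 < ip x x)
    (ip_invariant : ip.lieInvariant 𝔤)
    (c : NonlinearChoice) {N : ℕ} (τ : Fin (N + 1) → ℝ) (hτ₀ : τ 0 = 0) (hτ : StrictMono τ)
    (A E : Fin (N + 1) → Xcurl B k ⊗[ℝ] 𝔤) (lam : Fin (N + 1) → Xgrad B k ⊗[ℝ] 𝔤)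
    (h : IsSolution S ip c τ A E lam) (q : Xgrad B k ⊗[ℝ] 𝔤) (m n : Fin (N + 1)) :
    constraint S ip (A m) (E m) q = constraint S ip (A n) (E n) q :=
  proposition1_general S ip_symm ip_invariant (fun i => (hτ i.castSucc_lt_succ).ne) h.potential_eq
    (fun i => h.constraint_eq i q) m n
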